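/- Let $\mathbf M$ be a globally hyperbolic (time-oriented, Lorentzian) manifold and let $\mathfrak A$ be a von Neumann QFT on $\mathbf M$: a map from the open, causally convex subsets of $\mathbf M$ to von Neumann algebras on a complex Hilbert space $\mathcal H$ such that $\mathfrak A(\mathbf R)$ is non-Abelian for $\mathbf R\neq\emptyset$, $\mathfrak A(\mathbf R)\subseteq\mathfrak A(\mathbf S)$ if $\mathbf R\subseteq\mathbf S$, and $[\mathfrak A(\mathbf R),\mathfrak A(\mathbf S)]=0$ if $\mathbf R,\mathbf S$ are spacelike separated. For an arbitrary subset $\mathbf T\subseteq\mathbf M$ let $\mathfrak A(\mathbf T)$ be the von Neumann algebra generated by all $\mathfrak A(\mathbf R)$ with $\mathbf R\subseteq\mathbf T$ open and causally convex, and let $\mathbf T^\perp=\mathbf M\setminus(J^+(\mathbf T)\cup J^-(\mathbf T))$. A channel is a unital completely positive linear map $\Phi:\mathfrak A(\mathbf M)\to\mathfrak A(\mathbf M)$. It is local to $\mathbf K$ if $\Phi(O)=O$ for all $O\in\mathfrak A(\mathbf K^\perp)$. A channel $\Phi$ local to $\mathbf K$ is causal if $\rho\big(\Phi_{\mathbf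 S}(\Phi(O))-\Phi(O)\big)=0$ for all states $\rho$ on $\mathfrak A(\mathbf M)$, all spacelike separated compact sets $\mathbf S\subseteq \mathbf M\setminus J^+(\mathbf K)$ and $\mathbf R\subseteq\mathbf M\setminus J^-(\mathbf K)$, all $O\in\mathfrak A(\mathbf R)$ and all channels $\Phi_{\mathbf S}$ local to $\mathbf S$; otherwise it is acausal. Let $\mathrm U(\mathbf K)$ be the group of unitaries in the commutant $\mathfrak A(\mathbf K^\perp)'\subseteq\mathcal B(\mathcal H)$, with the strong operator topology (SOT), and let $\mathrm{CauU}(\mathbf K)\subseteq\mathrm U(\mathbf K)$ be the set of those $U$ for which $O\mapsto U^\dagger OU$ is a causal channel of $\mathfrak A(\mathbf M)$ local to $\mathbf K$. Theorem. Suppose that each local algebra $\mathfrak A(\mathbf R)$ ($\mathbf R\ne\emptyset$ open and causally convex) is SOT-separable or properly infinite, and that for every compact $\mathbf S\subseteq\mathbf M$ the unitaries local to $\mathbf S$ define channels of the QFT, i.e. $U^\dagger\mathfrak A(\mathbf M)U\subseteq\mathfrak A(\mathbf M)$ for all $U\in\mathrm U(\mathbf S)$ (this is automatic if $\mathfrak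 A(\mathbf M)=\mathcal B(\mathcal H)$). Let $\mathbf K\subseteq\mathbf M$ be any subset such that there exists an acausal channel local to $\mathbf K$. Then $\mathrm{CauU}(\mathbf K)$ is a meagre subset of $\mathrm U(\mathbf K)$ with respect to the SOT. -/

import Mathlib

open scoped Manifold ContDiff ComplexOrder InnerProductSpace

/-! ### Spacetimes and their causal structure -/

/-- A smooth Lorentzian metric of signature `(-,+,…,+)` on the manifold `M` (modelled on `E`),
together with a time orientation, given by a continuous timelike vector field. -/
structure Spacetime (E : Type*) [NormedAddCommGroup E] [NormedSpace ℝ E]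
    (M : Type*) [TopologicalSpace M] [ChartedSpace E M] [IsManifold 𝓘(ℝ, E) ∞ M] where
  /-- The metric tensor. -/
  metric (x : M) : TangentSpace 𝓘(ℝ, E) x →L[ℝ] TangentSpace 𝓘(ℝ, E) x →L[ℝ] ℝ
  metric_symm (x : M) (v w : TangentSpace 𝓘(ℝ, E) x) : metric x v w = metric x w v
  /-- Signature `(-,+,…,+)`: some vector is timelike, and the metric is positive definite on its
  orthogonal complement. -/
  metric_lorentzian (x : M) : ∃ v : TangentSpace 𝓘(ℝ, E) x, metric x v v < 0 ∧
    ∀ w : TangentSpace 𝓘(ℝ, E) x, metric x v w = 0 → w ≠ 0 → 0 < metric x w w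
  metric_contMDiff : ContMDiff 𝓘(ℝ, E) (𝓘(ℝ, E).prod 𝓘(ℝ, E →L[ℝ] E →L[ℝ] ℝ)) ∞
    (fun x ↦ Bundle.TotalSpace.mk' (E →L[ℝ] E →L[ℝ] ℝ)
      (E := fun x : M ↦ TangentSpace 𝓘(ℝ, E) x →L[ℝ] TangentSpace 𝓘(ℝ, E) x →L[ℝ] ℝ)
      x (metric x))
  /-- The vector field that fixes the time orientation. -/
  timeField (x : M) : TangentSpace 𝓘(ℝ, E) x
  timeField_continuous :
    Continuous (fun x ↦ (⟨x, timeField x⟩ : TangentBundle 𝓘(ℝ, E) M))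
  timeField_timelike (x : M) : metric x (timeField x) (timeField x) < 0

namespace Spacetime

variable {E : Type*} [NormedAddCommGroup E] [NormedSpace ℝ E]
  {M : Type*} [TopologicalSpace M] [ChartedSpace E M] [IsManifold 𝓘(ℝ, E) ∞ M]

/-- Future-directed causal (timelike or lightlike, nonzero) tangent vectors. -/
def IsFutureCausal (g : Spacetime E M) (x : M) (v : TangentSpace 𝓘(ℝ, E) x) : Prop :=
  v ≠ 0 ∧ g.metric x v v ≤ 0 ∧ g.metric x (g.timeField x) v < 0

/-- There is a smooth future-directed causal curve segment from `p` to `q`. -/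
def CausalSegment (g : Spacetime E M) (p q : M) : Prop :=
  ∃ γ : ℝ → M, ContMDiffOn 𝓘(ℝ, ℝ) 𝓘(ℝ, E) ∞ γ (Set.Icc 0 1) ∧ γ 0 = p ∧ γ 1 = q ∧
    ∀ t ∈ Set.Icc (0 : ℝ) 1, g.IsFutureCausal (γ t)
      (mfderivWithin 𝓘(ℝ, ℝ) 𝓘(ℝ, E) γ (Set.Icc 0 1) t (1 : ℝ))

/-- The causal relation `p ≤ q`: either `p = q`, or there is a piecewise smooth future-directed
causal curve from `p` to `q`. -/
def CausallyPrecedes (g : Spacetime E M) (p q : M) : Prop :=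
  Relation.ReflTransGen g.CausalSegment p q

/-- The causal future `J⁺(T)`. -/
def causalFuture (g : Spacetime E M) (T : Set M) : Set M :=
  {q | ∃ p ∈ T, g.CausallyPrecedes p q}

/-- The causal past `J⁻(T)`. -/
def causalPast (g : Spacetime E M) (T : Set M) : Set M :=
  {q | ∃ p ∈ T, g.CausallyPrecedes q p}

/-- Global hyperbolicity: there are no closed causal curves, and all causal diamonds
`J⁺(p) ∩ J⁻(q)` are compact. -/
def GloballyHyperbolic (g : Spacetime E M) : Prop :=
  (∀ p q : M, g.CausallyPrecedes p q → g.CausallyPrecedes q p → p = q) ∧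
    ∀ p q : M, IsCompact (g.causalFuture {p} ∩ g.causalPast {q})

/-- Causal convexity: every causal curve between two points of `T` stays in `T`. -/
def CausallyConvex (g : Spacetime E M) (T : Set M) : Prop :=
  ∀ p ∈ T, ∀ q ∈ T, g.causalFuture {p} ∩ g.causalPast {q} ⊆ T

/-- The spacelike complement `T^⊥`: all points that are spacelike separated from `T`. -/
def spacelikeComplement (g : Spacetime E M) (T : Set M) : Set M :=
  (g.causalFuture T ∪ g.causalPast T)ᶜ

/-- Spacelike separation of two sets. -/
def SpacelikeSeparated (g : Spacetime E M) (S T : Set M) : Prop :=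
  S ⊆ g.spacelikeComplement T

/-- The in-region `M \ J⁺(K)`. -/
def inRegion (g : Spacetime E M) (K : Set M) : Set M := (g.causalFuture K)ᶜ

/-- The out-region `M \ J⁻(K)`. -/
def outRegion (g : Spacetime E M) (K : Set M) : Set M := (g.causalPast K)ᶜ

/-- Open, causally convex subsets of `M`. -/
def Region (g : Spacetime E M) : Type _ :=
  {R : Set M // IsOpen R ∧ g.CausallyConvex R}

end Spacetime

/-! ### Von Neumann algebras -/

section VonNeumann

variable {H : Type*} [NormedAddCommGroup H] [InnerProductSpace ℂ H] [CompleteSpace H]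

/-- The von Neumann algebra generated by a set of bounded operators. -/
noncomputable def vonNeumannGenerated (X : Set (H →L[ℂ] H)) : VonNeumannAlgebra H where
  toStarSubalgebra :=
    StarSubalgebra.centralizer ℂ (StarSubalgebra.centralizer ℂ X : Set (H →L[ℂ] H))
  centralizer_centralizer' := by simp

variable (H) in
/-- The strong operator topology on the bounded operators, i.e. the topology of pointwise
convergence on `H`. -/
abbrev strongOperatorTopology : TopologicalSpace (H →L[ℂ] H) :=
  TopologicalSpace.induced (fun (a : H →L[ℂ] H) (x : H) ↦ a x) inferInstance

/-- The von Neumann algebra `N` is separable in the strong operator topology. -/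
def SOTSeparable (N : VonNeumannAlgebra H) : Prop :=
  ∃ D : Set (H →L[ℂ] H), D.Countable ∧ D ⊆ N ∧
    (N : Set (H →L[ℂ] H)) ⊆ @closure _ (strongOperatorTopology H) D

/-- The von Neumann algebra `N` is properly infinite: every nonzero central projection `z` is
infinite, that is, Murray-von Neumann equivalent in `N` to a proper subprojection of itself. -/
def ProperlyInfinite (N : VonNeumannAlgebra H) : Prop :=
  ∀ z : H →L[ℂ] H, z ∈ N → z ∈ N.commutant → IsStarProjection z → z ≠ 0 →
    ∃ v ∈ N, star v * v = z ∧ v * star v ≤ z ∧ v * star v ≠ z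

/-- A `k × k` matrix of operators is positive as an operator on `H ⊕ ⋯ ⊕ H`. -/
def PositiveOperatorMatrix {k : ℕ} (a : Matrix (Fin k) (Fin k) (H →L[ℂ] H)) : Prop :=
  ∀ x : Fin k → H, 0 ≤ ∑ i, ∑ j, ⟪x i, a i j (x j)⟫_ℂ

/-- Channels: unital completely positive linear maps of a von Neumann algebra to itself. -/
structure Channel (N : VonNeumannAlgebra H) where
  /-- The underlying linear map. -/
  toLinearMap : N.toStarSubalgebra →ₗ[ℂ] N.toStarSubalgebra
  map_one : toLinearMap 1 = 1
  completelyPositive (k : ℕ) (a : Matrix (Fin k) (Fin k) N.toStarSubalgebra) :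
    PositiveOperatorMatrix (fun i j ↦ (a i j : H →L[ℂ] H)) →
      PositiveOperatorMatrix (fun i j ↦ (toLinearMap (a i j) : H →L[ℂ] H))

/-- States: positive linear functionals of value `1` at the identity. -/
structure AlgState (N : VonNeumannAlgebra H) where
  /-- The underlying linear functional. -/
  toLinearMap : N.toStarSubalgebra →ₗ[ℂ] ℂ
  map_one : toLinearMap 1 = 1
  nonneg (a : N.toStarSubalgebra) : 0 ≤ toLinearMap (star a * a)

end VonNeumann

/-! ### Quantum field theories, local and causal channels -/

/-- A von Neumann QFT on the spacetime `g`: an isotone assignment of von Neumann algebras on `H`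
to the open, causally convex sets, with commuting algebras for spacelike separated sets. The
algebras are non-Abelian; only the empty set, which is spacelike separated from itself and so
always has an Abelian algebra, has to be exempted. -/
structure VonNeumannQFT {E : Type*} [NormedAddCommGroup E] [NormedSpace ℝ E]
    {M : Type*} [TopologicalSpace M] [ChartedSpace E M] [IsManifold 𝓘(ℝ, E) ∞ M]
    (g : Spacetime E M)
    (H : Type*) [NormedAddCommGroup H] [InnerProductSpace ℂ H] [CompleteSpace H] where
  /-- The algebra of an open, causally convex set. -/
  localAlgebra : g.Region → VonNeumannAlgebra H
  isotone (R S : g.Region) : R.1 ⊆ S.1 → localAlgebra R ≤ localAlgebra S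
  commute (R S : g.Region) : g.SpacelikeSeparated R.1 S.1 →
    ∀ a ∈ localAlgebra R, ∀ b ∈ localAlgebra S, a * b = b * a
  nonabelian (R : g.Region) : R.1.Nonempty →
    ∃ a ∈ localAlgebra R, ∃ b ∈ localAlgebra R, a * b ≠ b * a

namespace VonNeumannQFT

variable {E : Type*} [NormedAddCommGroup E] [NormedSpace ℝ E]
  {M : Type*} [TopologicalSpace M] [ChartedSpace E M] [IsManifold 𝓘(ℝ, E) ∞ M]
  {g : Spacetime E M}
  {H : Type*} [NormedAddCommGroup H] [InnerProductSpace ℂ H] [CompleteSpace H]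

/-- The algebra of an arbitrary (for instance compact) subset `T` of `M`: the von Neumann algebra
generated by the algebras of all open, causally convex sets inside `T`. -/
noncomputable def algebra (A : VonNeumannQFT g H) (T : Set M) : VonNeumannAlgebra H :=
  vonNeumannGenerated {a | ∃ R : g.Region, R.1 ⊆ T ∧ a ∈ A.localAlgebra R}

/-- On open, causally convex sets nothing new is defined. -/
theorem algebra_region (A : VonNeumannQFT g H) (R : g.Region) :
    A.algebra R.1 = A.localAlgebra R := by
  have h : {a | ∃ S : g.Region, S.1 ⊆ R.1 ∧ a ∈ A.localAlgebra S} =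
      (A.localAlgebra R : Set (H →L[ℂ] H)) := by
    ext a
    exact ⟨fun ⟨S, hS, ha⟩ ↦ A.isotone S R hS ha, fun ha ↦ ⟨R, subset_rfl, ha⟩⟩
  apply SetLike.coe_injective
  change ((StarSubalgebra.centralizer ℂ (StarSubalgebra.centralizer ℂ
    {a | ∃ S : g.Region, S.1 ⊆ R.1 ∧ a ∈ A.localAlgebra S} : Set (H →L[ℂ] H))) :
      Set (H →L[ℂ] H)) = _
  rw [h]
  exact congrArg (fun N : VonNeumannAlgebra H ↦ (N : Set (H →L[ℂ] H)))
    (A.localAlgebra R).commutant_commutant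

/-- The global algebra `𝔄(M)`. -/
noncomputable abbrev globalAlgebra (A : VonNeumannQFT g H) : VonNeumannAlgebra H :=
  A.algebra Set.univ

/-- A channel of `𝔄(M)` is local to `K` if it acts as the identity on `𝔄(K^⊥)`. -/
def IsLocalChannel (A : VonNeumannQFT g H) (K : Set M) (Φ : Channel A.globalAlgebra) : Prop :=
  ∀ a : A.globalAlgebra.toStarSubalgebra,
    (a : H →L[ℂ] H) ∈ A.algebra (g.spacelikeComplement K) → Φ.toLinearMap a = a

/-- A channel local to `K` is causal if, for all spacelike separated compact sets `S` in the
in-region and `R` in the out-region of `K`, no channel local to `S` that is applied beforehand can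
be detected by measuring an operator of `𝔄(R)` afterwards, in any state. -/
def IsCausalChannel (A : VonNeumannQFT g H) (K : Set M) (Φ : Channel A.globalAlgebra) : Prop :=
  A.IsLocalChannel K Φ ∧
    ∀ S R : Set M, IsCompact S → IsCompact R → S ⊆ g.inRegion K → R ⊆ g.outRegion K →
      g.SpacelikeSeparated S R →
      ∀ Ψ : Channel A.globalAlgebra, A.IsLocalChannel S Ψ →
      ∀ a : A.globalAlgebra.toStarSubalgebra, (a : H →L[ℂ] H) ∈ A.algebra R →
      ∀ ρ : AlgState A.globalAlgebra,
        ρ.toLinearMap (Ψ.toLinearMap (Φ.toLinearMap a) - Φ.toLinearMap a) = 0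

/-- The group `U(K) = U(𝔄(K^⊥)')` of unitaries local to `K`. -/
def LocalUnitary (A : VonNeumannQFT g H) (K : Set M) : Type _ :=
  {U : H →L[ℂ] H // U ∈ unitary (H →L[ℂ] H) ∧
    U ∈ (A.algebra (g.spacelikeComplement K)).commutant}

/-- `U(K)` carries the strong operator topology. -/
instance (A : VonNeumannQFT g H) (K : Set M) : TopologicalSpace (A.LocalUnitary K) :=
  TopologicalSpace.induced Subtype.val (strongOperatorTopology H)

/-- The causal unitaries `CauU(K)`: those `U` in `U(K)` for which `a ↦ U† a U` is a causal channel
of `𝔄(M)`. -/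
def causalUnitaries (A : VonNeumannQFT g H) (K : Set M) : Set (A.LocalUnitary K) :=
  {U | ∃ Φ : Channel A.globalAlgebra, A.IsCausalChannel K Φ ∧
    ∀ a : A.globalAlgebra.toStarSubalgebra,
      (Φ.toLinearMap a : H →L[ℂ] H) = star U.1 * (a : H →L[ℂ] H) * U.1}

/-- The unitaries local to a compact set `S` define channels of `𝔄(M)`, that is, conjugation by
them maps `𝔄(M)` to itself. This is automatic if `𝔄(M)` consists of all bounded operators. -/
def UnitariesDefineChannels (A : VonNeumannQFT g H) : Prop :=
  ∀ S : Set M, IsCompact S → ∀ U : A.LocalUnitary S, ∀ a ∈ A.globalAlgebra,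
    star U.1 * a * U.1 ∈ A.globalAlgebra

end VonNeumannQFT

/-! ### Generated von Neumann algebras and their derivations -/

section OperatorAlgebras

variable {H : Type*} [NormedAddCommGroup H] [InnerProductSpace ℂ H] [CompleteSpace H]

/-! Compact sets `S`, `R` witnessing the acausality of one channel `Φ` are fixed once and for all.
Causal unitaries conjugate `𝔄(R)` into `𝔄(S^⊥)` (`causalUnitaries_subset`), and the unitaries that
do so form an SOT-closed set (`isClosed_localizingUnitaries`). It remains to see that this closed
set has empty interior.

If it contains an open neighbourhood of some `U`, then differentiating along `U exp(tk)`, with `k`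
skew-adjoint in `B = 𝔄(K^⊥)'`, shows that all nested commutators of `U† b U`, `b ∈ 𝔄(R)`, with such
`k` lie in `𝔄(S^⊥)`. They generate a von Neumann algebra `N ⊆ 𝔄(S^⊥)` with `[B, N] ⊆ N`.

The algebraic core is `exists_central_projection`: this invariance is only possible if a projection
`z`, central in `N` and commuting with `B`, satisfies `B z ⊆ N` and `B (1 - z) ⊆ N'`. Hence `N` is
invariant under conjugation by unitaries of `B`, and so contains `𝔄(R)` itself. Every channel local
to `K` is a bimodule map over `𝔄(K^⊥) = B'`. For `a ∈ 𝔄(R)` it fixes `a (1 - z)`, which lies in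
`B'`, and maps `a z` to an operator that still commutes with `N' z ⊆ B'`. So it maps `𝔄(R)` into `N
⊆ 𝔄(S^⊥)`, where every channel local to `S` acts trivially. This contradicts the choice of `S`, `R`
and `Φ`. -/

theorem mem_commutant_vonNeumannGenerated {X : Set (H →L[ℂ] H)} (hX : ∀ x ∈ X, star x ∈ X)
    {y : H →L[ℂ] H} :
    y ∈ (vonNeumannGenerated X).commutant ↔ ∀ x ∈ X, x * y = y * x := by
  have key : ((vonNeumannGenerated X).commutant : Set (H →L[ℂ] H)) =
      StarSubalgebra.centralizer ℂ X := by
    rw [VonNeumannAlgebra.coe_commutant]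
    change Set.centralizer ((StarSubalgebra.centralizer ℂ
      (StarSubalgebra.centralizer ℂ X : Set (H →L[ℂ] H))) : Set (H →L[ℂ] H)) = _
    rw [StarSubalgebra.coe_centralizer_centralizer]
    simp [Set.centralizer_centralizer_centralizer, StarSubalgebra.coe_centralizer]
  rw [← SetLike.mem_coe, key, SetLike.mem_coe, StarSubalgebra.mem_centralizer_iff]
  exact ⟨fun h x hx ↦ (h x hx).1, fun h x hx ↦ ⟨h x hx, h _ (hX x hx)⟩⟩

theorem subset_vonNeumannGenerated (X : Set (H →L[ℂ] H)) {x : H →L[ℂ] H} (hx : x ∈ X) :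
    x ∈ vonNeumannGenerated X := by
  change x ∈ StarSubalgebra.centralizer ℂ (StarSubalgebra.centralizer ℂ X : Set (H →L[ℂ] H))
  rw [StarSubalgebra.mem_centralizer_iff]
  intro g hg
  have hg' := StarSubalgebra.mem_centralizer_iff (R := ℂ).1 hg
  have hg'' := StarSubalgebra.mem_centralizer_iff (R := ℂ).1 (star_mem hg)
  exact ⟨((hg' x hx).1).symm, ((hg'' x hx).1).symm⟩

namespace VonNeumannAlgebra

theorem mem_of_forall_commutant {N : VonNeumannAlgebra H} {x : H →L[ℂ] H}
    (h : ∀ y ∈ N.commutant, y * x = x * y) : x ∈ N := by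
  rw [← N.commutant_commutant, mem_commutant_iff]
  exact h

theorem commute_of_mem {N : VonNeumannAlgebra H} {x y : H →L[ℂ] H}
    (hx : x ∈ N) (hy : y ∈ N.commutant) : x * y = y * x :=
  mem_commutant_iff.1 hy x hx

theorem smul_mem (N : VonNeumannAlgebra H) (c : ℂ) {x : H →L[ℂ] H} (hx : x ∈ N) : c • x ∈ N :=
  N.toStarSubalgebra.smul_mem hx c

theorem real_smul_mem (N : VonNeumannAlgebra H) (c : ℝ) {x : H →L[ℂ] H} (hx : x ∈ N) :
    c • x ∈ N :=
  N.smul_mem (c : ℂ) hx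

theorem exp_mem (N : VonNeumannAlgebra H) {k : H →L[ℂ] H} (hk : k ∈ N) :
    NormedSpace.exp k ∈ N :=
  mem_of_forall_commutant fun y hy ↦
    ((show Commute y k from (commute_of_mem hk hy).symm).exp_right).eq

/-- A derivation that maps generators of a von Neumann algebra into it preserves the algebra. -/
theorem commutator_mem_of_generators {X : Set (H →L[ℂ] H)} (hX : ∀ x ∈ X, star x ∈ X)
    {k : H →L[ℂ] H} (hk : ∀ x ∈ X, k * x - x * k ∈ vonNeumannGenerated X)
    {x : H →L[ℂ] H} (hx : x ∈ vonNeumannGenerated X) :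
    k * x - x * k ∈ vonNeumannGenerated X := by
  refine mem_of_forall_commutant fun y hy ↦ ?_
  -- By the Jacobi identity `[y, k]` commutes with the generators. A second use of Jacobi then moves
  -- the derivation from `y` back to `x`.
  have hd : y * k - k * y ∈ (vonNeumannGenerated X).commutant := by
    rw [mem_commutant_vonNeumannGenerated hX]
    intro u hu
    have h1 := commute_of_mem (hk u hu) hy
    have h2 := commute_of_mem (subset_vonNeumannGenerated X hu) hy
    have e : u * (y * k - k * y) - (y * k - k * y) * u =
        ((k * u - u * k) * y - y * (k * u - u * k)) - (k * (u * y - y * u))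
          + (u * y - y * u) * k := by noncomm_ring
    rw [← sub_eq_zero, e, h1, h2]
    simp
  have h1 := commute_of_mem hx hd
  have h2 := commute_of_mem hx hy
  have e : y * (k * x - x * k) - (k * x - x * k) * y =
      - (x * (y * k - k * y) - (y * k - k * y) * x) + k * (y * x - x * y) - (y * x - x * y) * k := by
    noncomm_ring
  rw [← sub_eq_zero, e, h1, h2]
  simp

/-- Every element of a von Neumann algebra is `k + i l` with skew-adjoint `k` and `l` in it. -/
theorem exists_skewAdjoint_add (B : VonNeumannAlgebra H) {b : H →L[ℂ] H} (hb : b ∈ B) :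
    ∃ k ∈ B, ∃ l ∈ B, star k = -k ∧ star l = -l ∧ b = k + Complex.I • l := by
  refine ⟨(2⁻¹ : ℂ) • (b - star b), B.smul_mem _ (sub_mem hb (star_mem hb)),
    (-(2⁻¹ * Complex.I) : ℂ) • (b + star b), B.smul_mem _ (add_mem hb (star_mem hb)), ?_, ?_, ?_⟩
  · simp [star_smul, ← smul_neg]
  · simp [star_smul, add_comm, ← neg_smul]
  · rw [smul_smul]
    have : Complex.I * -(2⁻¹ * Complex.I) = 2⁻¹ := by
      linear_combination (-2⁻¹ : ℂ) * Complex.I_mul_I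
    rw [this, ← smul_add, show b - star b + (b + star b) = (2 : ℂ) • b by rw [two_smul]; abel,
      smul_smul]
    norm_num

end VonNeumannAlgebra
end OperatorAlgebras

/-! ### Splitting of an algebra whose derivations preserve `N` -/

section OperatorAlgebras

variable {H : Type*} [NormedAddCommGroup H] [InnerProductSpace ℂ H] [CompleteSpace H]

namespace VonNeumannAlgebra

section Derivations

variable {N B : VonNeumannAlgebra H} (hder : ∀ b ∈ B, ∀ x ∈ N, b * x - x * b ∈ N)
include hder

/-- The squares of `B` also act as derivations of `N`, and `[h², c] + [h, [h, c]] = 2 h [h, c]`. -/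
theorem mul_commutator_self_mem {h c : H →L[ℂ] H} (hh : h ∈ B) (hc : c ∈ N) :
    h * (h * c - c * h) ∈ N := by
  have h1 := add_mem (hder (h * h) (mul_mem hh hh) c hc) (hder h hh _ (hder h hh c hc))
  have h2 := N.smul_mem 2⁻¹ h1
  have e : h * h * c - c * (h * h) + (h * (h * c - c * h) - (h * c - c * h) * h) =
      (2 : ℂ) • (h * (h * c - c * h)) := by
    rw [two_smul]; noncomm_ring
  rw [e, smul_smul] at h2
  simpa using h2

theorem mul_mul_commutator_self_mem {h x c : H →L[ℂ] H} (hh : h ∈ B) (hx : x ∈ N) (hc : c ∈ N) :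
    h * (x * (h * c - c * h)) ∈ N := by
  have e : h * (x * (h * c - c * h)) =
      h * (h * (x * c) - x * c * h) - h * (h * x - x * h) * c := by noncomm_ring
  rw [e]
  exact sub_mem (mul_commutator_self_mem hder hh (mul_mem hx hc))
    (mul_mem (mul_commutator_self_mem hder hh hx) hc)

/-- With `w = x [h, c]`, both `w` and `h w` lie in `N`, so `y` commutes with both. -/
theorem commutator_mul_commutator_self_eq_zero {y h x c : H →L[ℂ] H} (hy : y ∈ N.commutant)
    (hh : h ∈ B) (hx : x ∈ N) (hc : c ∈ N) :
    (y * h - h * y) * (x * (h * c - c * h)) = 0 := by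
  have h1 := commute_of_mem (mul_mul_commutator_self_mem hder hh hx hc) hy
  have h2 := commute_of_mem (mul_mem hx (hder h hh c hc)) hy
  rw [sub_mul, mul_assoc y h, ← h1, mul_assoc h y, ← h2]
  simp [mul_assoc]

/-- Polarizing the case `h = k` gives `T = -[y, k] x [h, c]`. Since `h` is skew-adjoint, `T†` then
starts with `[h, c†]` up to sign, and `T [h, c†] = 0` by the case `h = k` with `x [k, c]` in place
of `x`. So `T T† = 0`. -/
theorem commutator_mul_commutator_eq_zero_of_skewAdjoint {y h k x c : H →L[ℂ] H}
    (hy : y ∈ N.commutant) (hh : h ∈ B) (hskew : star h = -h) (hk : k ∈ B) (hx : x ∈ N)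
    (hc : c ∈ N) : (y * h - h * y) * (x * (k * c - c * k)) = 0 := by
  set T := (y * h - h * y) * (x * (k * c - c * k)) with hT
  have h1 := commutator_mul_commutator_self_eq_zero hder hy hh hx hc
  have h2 := commutator_mul_commutator_self_eq_zero hder hy hk hx hc
  have h3 := commutator_mul_commutator_self_eq_zero hder hy (add_mem hh hk) hx hc
  have hT' : T = -((y * k - k * y) * (x * (h * c - c * h))) := by
    rw [← sub_eq_zero, ← h3, hT]
    have e : (y * (h + k) - (h + k) * y) * (x * ((h + k) * c - c * (h + k))) =
      (y * h - h * y) * (x * (h * c - c * h)) + (y * k - k * y) * (x * (k * c - c * k)) +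
      ((y * h - h * y) * (x * (k * c - c * k)) + (y * k - k * y) * (x * (h * c - c * h))) := by
      noncomm_ring
    rw [e, h1, h2]
    abel
  have h4 : T * (h * star c - star c * h) = 0 := by
    have := commutator_mul_commutator_self_eq_zero hder hy hh (mul_mem hx (hder k hk c hc))
      (star_mem hc)
    rw [hT, ← this]
    simp only [mul_assoc]
  have h5 : T * star T = 0 := by
    have e : star T = -((h * star c - star c * h) * (star x * star (y * k - k * y))) := by
      rw [hT']
      simp only [star_neg, star_mul, star_sub, hskew]
      noncomm_ring
    rw [e, mul_neg, ← mul_assoc, h4]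
    simp
  exact (CStarRing.mul_star_self_eq_zero_iff T).1 h5

theorem commutator_mul_commutator_eq_zero {y h k x c : H →L[ℂ] H}
    (hy : y ∈ N.commutant) (hh : h ∈ B) (hk : k ∈ B) (hx : x ∈ N)
    (hc : c ∈ N) : (y * h - h * y) * (x * (k * c - c * k)) = 0 := by
  obtain ⟨p, hp, q, hq, hps, hqs, rfl⟩ := B.exists_skewAdjoint_add hh
  have h1 := commutator_mul_commutator_eq_zero_of_skewAdjoint hder hy hp hps hk hx hc
  have h2 := commutator_mul_commutator_eq_zero_of_skewAdjoint hder hy hq hqs hk hx hc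
  have e : y * (p + Complex.I • q) - (p + Complex.I • q) * y =
      (y * p - p * y) + Complex.I • (y * q - q * y) := by
    rw [mul_add, add_mul, mul_smul_comm, smul_mul_assoc, smul_sub]; abel
  rw [e, add_mul, h1, smul_mul_assoc, h2]
  simp

/-- If all derivations `[b, ·]` with `b ∈ B` preserve `N`, a central projection of `N` that
commutes with `B` splits `B` into a part inside `N` and a part inside the commutant of `N`. -/
theorem exists_central_projection :
    ∃ z : H →L[ℂ] H, IsIdempotentElem z ∧ z ∈ N ∧ z ∈ N.commutant ∧ z ∈ B.commutant ∧
      (∀ b ∈ B, b * z ∈ N) ∧ ∀ b ∈ B, b * (1 - z) ∈ N.commutant := by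
  -- `z` projects onto the closed span `L` of the ranges of all `x [k, c]`. This space is invariant
  -- under `N`, `N'` and `B`, and every `[y, b]` with `y ∈ N'` vanishes on it.
  let X : Set H := {v | ∃ x ∈ N, ∃ k ∈ B, ∃ c ∈ N, ∃ ξ : H, v = (x * (k * c - c * k)) ξ}
  let L : Submodule ℂ H := (Submodule.span ℂ X).topologicalClosure
  have hLc : IsClosed (L : Set H) := Submodule.isClosed_topologicalClosure _
  have : CompleteSpace L := hLc.completeSpace_coe
  have hXL : ∀ v ∈ X, v ∈ L := fun v hv ↦
    Submodule.le_topologicalClosure _ (Submodule.subset_span hv)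
  have hinv : ∀ (T : H →L[ℂ] H) (L' : Submodule ℂ H), IsClosed (L' : Set H) →
      (∀ v ∈ X, T v ∈ L') → ∀ v ∈ L, T v ∈ L' := by
    intro T L' hL' hT v hv
    have : L ≤ L'.comap (T : H →ₗ[ℂ] H) :=
      Submodule.topologicalClosure_minimal _ (Submodule.span_le.2 hT)
        (hL'.preimage T.continuous)
    exact this hv
  let z : H →L[ℂ] H := L.starProjection
  have hz : IsStarProjection z := isStarProjection_starProjection
  have hzmem : ∀ S : VonNeumannAlgebra H,
      (∀ T ∈ S.commutant, ∀ v ∈ X, T v ∈ L) → z ∈ S := by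
    intro S hS
    rw [IsStarProjection.mem_iff hz]
    intro T hT
    rw [show (z.range : Submodule ℂ H) = L from Submodule.range_starProjection L]
    exact hinv T L hLc (hS T hT)
  have hzL : ∀ v ∈ L, z v = v := fun v hv ↦ Submodule.starProjection_eq_self_iff.2 hv
  have hzN : z ∈ N := by
    refine hzmem N ?_
    rintro T hT _ ⟨x, hx, k, hk, c, hc, ξ, rfl⟩
    refine hXL _ ⟨x, hx, k, hk, c, hc, T ξ, ?_⟩
    exact congrArg (fun S : H →L[ℂ] H ↦ S ξ)
      (commute_of_mem (mul_mem hx (hder k hk c hc)) hT).symm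
  have hzN' : z ∈ N.commutant := by
    refine hzmem _ ?_
    rw [commutant_commutant]
    rintro T hT _ ⟨x, hx, k, hk, c, hc, ξ, rfl⟩
    exact hXL _ ⟨T * x, mul_mem hT hx, k, hk, c, hc, ξ, by simp⟩
  have hzB : z ∈ B.commutant := by
    refine hzmem _ ?_
    rw [commutant_commutant]
    rintro b hb _ ⟨x, hx, k, hk, c, hc, ξ, rfl⟩
    have e : b * (x * (k * c - c * k)) = (b * x - x * b) * (k * c - c * k) +
        1 * x * (b * (k * c - c * k) - (k * c - c * k) * b) + x * (k * c - c * k) * b := by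
      noncomm_ring
    have e' : b ((x * (k * c - c * k)) ξ) = ((b * x - x * b) * (k * c - c * k)) ξ +
        (x * (b * (k * c - c * k) - (k * c - c * k) * b)) ξ + (x * (k * c - c * k)) (b ξ) := by
      simpa only [mul_apply_eq_comp, add_apply, one_mul] using
        congrArg (fun S : H →L[ℂ] H ↦ S ξ) e
    rw [e']
    exact L.add_mem (L.add_mem (hXL _ ⟨_, hder b hb x hx, k, hk, c, hc, ξ, rfl⟩)
      (hXL _ ⟨x, hx, b, hb, _, hder k hk c hc, ξ, rfl⟩))
      (hXL _ ⟨x, hx, k, hk, c, hc, b ξ, rfl⟩)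
  refine ⟨z, hz.isIdempotentElem, hzN, hzN', hzB, fun b hb ↦ ?_, fun b hb ↦ ?_⟩
  · refine mem_of_forall_commutant fun y hy ↦ ?_
    have h0 : (y * b - b * y) * z = 0 := by
      ext ξ
      have hmem : z ξ ∈ L := Submodule.starProjection_apply_mem L ξ
      have := hinv (y * b - b * y) ⊥ (by simp) ?_ (z ξ) hmem
      · simpa using this
      · rintro _ ⟨x, hx, k, hk, c, hc, η, rfl⟩
        have := commutator_mul_commutator_eq_zero hder hy hb hk hx hc
        exact congrArg (fun S : H →L[ℂ] H ↦ S η) this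
    have h1 := commute_of_mem hzN hy
    rw [mul_assoc b z y, h1, ← sub_eq_zero, ← h0]
    noncomm_ring
  · rw [mem_commutant_iff]
    intro c hc
    have h0 : z * (b * c - c * b) = b * c - c * b := by
      ext ξ
      exact hzL _ (hXL _ ⟨1, one_mem N, b, hb, c, hc, ξ, by simp⟩)
    have h1 := commute_of_mem (hder b hb c hc) hzN'
    have h2 := commute_of_mem hc hzN'
    rw [← sub_eq_zero]
    have e : c * (b * (1 - z)) - b * (1 - z) * c =
      (b * c - c * b) * z - (b * c - c * b) - b * (c * z - z * c) := by noncomm_ring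
    rw [e, h1, h0, h2]
    simp

/-- On the range of `z` the unitary belongs to `N`; on the complement it commutes with `N` and
cancels. -/
theorem conj_unitary_mem {u x : H →L[ℂ] H} (hu : u ∈ B) (hu' : star u * u = 1)
    (hx : x ∈ N) : star u * x * u ∈ N := by
  obtain ⟨z, hz, hzN, hzN', hzB, hBz, hBz'⟩ := exists_central_projection hder
  have h1 := commute_of_mem hx (hBz' u hu)
  have h2 := commute_of_mem hx hzN'
  have e : star u * x * u = (star u * z) * x * (u * z) + x * (1 - z) := by
    have h3 := commute_of_mem hu hzB
    have e1 : (star u * z) * x * (u * z) = star u * x * (u * z) := by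
      calc (star u * z) * x * (u * z) = star u * (z * x) * (u * z) := by noncomm_ring
        _ = star u * x * (z * u) * z := by rw [← h2]; noncomm_ring
        _ = star u * x * u * (z * z) := by rw [← h3]; noncomm_ring
        _ = _ := by rw [hz.eq, mul_assoc]
    have e2 : star u * x * (u * (1 - z)) = x * (1 - z) := by
      calc star u * x * (u * (1 - z)) = star u * (x * (u * (1 - z))) := by rw [mul_assoc]
        _ = star u * u * ((1 - z) * x) := by rw [h1]; noncomm_ring
        _ = _ := by rw [hu', one_mul, sub_mul, mul_sub, h2]; simp
    rw [e1, ← e2]; noncomm_ring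
  rw [e]
  exact add_mem (mul_mem (mul_mem (hBz _ (star_mem hu)) hx) (hBz u hu))
    (mul_mem hx (sub_mem (one_mem N) hzN))

end Derivations

end VonNeumannAlgebra
end OperatorAlgebras

/-! ### Bimodule property of channels, and vector states -/

section Channels

variable {H : Type*} [NormedAddCommGroup H] [InnerProductSpace ℂ H] [CompleteSpace H]

theorem zero_le_inner_self_complex {H : Type*} [NormedAddCommGroup H] [InnerProductSpace ℂ H]
    (x : H) : 0 ≤ ⟪x, x⟫_ℂ := by
  rw [inner_self_eq_norm_sq_to_K]
  rw [RCLike.ofReal_eq_complex_ofReal, ← Complex.ofReal_pow, Complex.zero_le_real]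
  exact sq_nonneg ‖x‖

theorem positiveOperatorMatrix_star_mul {k : ℕ} (v : Fin k → H →L[ℂ] H) :
    PositiveOperatorMatrix (fun i j ↦ star (v i) * v j) := by
  intro x
  have e : ∑ i, ∑ j, ⟪x i, (star (v i) * v j) (x j)⟫_ℂ =
      ⟪∑ i, v i (x i), ∑ j, v j (x j)⟫_ℂ := by
    rw [sum_inner]
    refine Finset.sum_congr rfl fun i _ ↦ ?_
    rw [inner_sum]
    refine Finset.sum_congr rfl fun j _ ↦ ?_
    rw [ContinuousLinearMap.star_eq_adjoint, mul_apply_eq_comp,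
      ContinuousLinearMap.adjoint_inner_right]
  rw [e]
  exact zero_le_inner_self_complex _

theorem eq_zero_of_forall_nonneg {a b c : ℂ}
    (h : ∀ t : ℂ, 0 ≤ t * a + star t * b + star t * t * c) : a = 0 ∧ b = 0 := by
  have key : ∀ d : ℂ, (∀ t : ℝ, 0 ≤ (t : ℂ) * d + (t : ℂ) * t * c) → d = 0 := by
    intro d hd
    have hre : ∀ t : ℝ, 0 ≤ t * d.re + t * t * c.re := by
      intro t
      have := (Complex.le_def.1 (hd t)).1
      simpa using this
    have him : ∀ t : ℝ, 0 = t * d.im + t * t * c.im := by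
      intro t
      have := (Complex.le_def.1 (hd t)).2
      simpa using this
    have h1 := him 1
    have h2 := him (-1)
    refine Complex.ext ?_ (by simp; linarith)
    simp only [Complex.zero_re]
    by_contra hne
    have hc : 0 ≤ c.re := by
      have h3 := hre 1
      have h4 := hre (-1)
      linarith
    -- A small multiple of `-d.re` makes the linear term dominate; the `+ 1` keeps the denominator
    -- positive when `c.re = 0`.
    have h5 := hre (-(d.re / (c.re + 1)))
    have h6 : -(d.re / (c.re + 1)) * d.re + -(d.re / (c.re + 1)) * -(d.re / (c.re + 1)) * c.re =
        -(d.re ^ 2 / (c.re + 1) ^ 2) := by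
      field_simp
      ring
    rw [h6] at h5
    have : 0 < d.re ^ 2 / (c.re + 1) ^ 2 := by positivity
    linarith
  have h1 := key (a + b) fun t ↦ by
    have := h t
    simp only [Complex.star_def, Complex.conj_ofReal] at this
    rwa [mul_add]
  have h2 := key (Complex.I * (a - b)) fun t ↦ by
    have := h (t * Complex.I)
    simp only [Complex.star_def, map_mul, Complex.conj_ofReal, Complex.conj_I] at this
    convert! this using 1
    linear_combination ((t : ℂ) * t * c) * Complex.I_mul_I
  have h3 : a - b = 0 := (mul_eq_zero.1 h2).resolve_left Complex.I_ne_zero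
  exact ⟨by linear_combination (h1 + h3) / 2, by linear_combination (h1 - h3) / 2⟩

namespace Channel

variable {N : VonNeumannAlgebra H}

/-- A channel that fixes `p`, `p†` and `p† p` is compatible with multiplication by `p†` on the
left and by `p` on the right. -/
theorem map_star_mul_of_fixed (Φ : Channel N) {p : N.toStarSubalgebra} (hp : Φ.toLinearMap p = p)
    (hps : Φ.toLinearMap (star p) = star p) (hpp : Φ.toLinearMap (star p * p) = star p * p)
    (x : N.toStarSubalgebra) :
    Φ.toLinearMap (star p * x) = star p * Φ.toLinearMap x ∧
      Φ.toLinearMap (star x * p) = Φ.toLinearMap (star x) * p := by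
  let v : Fin 3 → N.toStarSubalgebra := ![1, p, x]
  have hpos := Φ.completelyPositive 3 (fun i j ↦ star (v i) * v j)
    (positiveOperatorMatrix_star_mul fun i ↦ (v i : H →L[ℂ] H))
  have hzero : ∀ ξ η : H,
      ⟪ξ, (Φ.toLinearMap (star p * x) - star p * Φ.toLinearMap x : H →L[ℂ] H) η⟫_ℂ = 0 ∧
      ⟪η, (Φ.toLinearMap (star x * p) - Φ.toLinearMap (star x) * p : H →L[ℂ] H) ξ⟫_ℂ = 0 := by
    intro ξ η
    refine eq_zero_of_forall_nonneg
      (c := ⟪η, (Φ.toLinearMap (star x * x) : H →L[ℂ] H) η⟫_ℂ) fun t ↦ ?_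
    -- The first two entries cancel all terms without `t`, because `Φ` fixes `1`, `p`, `p†` and `p†
    -- p`. The terms linear in `t` and in its conjugate are the two defects, which must therefore
    -- vanish.
    have := hpos ![-(p : H →L[ℂ] H) ξ, ξ, t • η]
    simp only [Fin.sum_univ_three, v] at this
    simp [hp, hps, hpp, Φ.map_one, inner_smul_left,
      ContinuousLinearMap.star_eq_adjoint, ContinuousLinearMap.adjoint_inner_right] at this ⊢
    convert! this using 1
    ring
  constructor
  · refine Subtype.ext (sub_eq_zero.1 ?_)
    ext η
    exact ext_inner_left ℂ fun ξ ↦ by simpa [inner_sub_right] using (hzero ξ η).1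
  · refine Subtype.ext (sub_eq_zero.1 ?_)
    ext ξ
    exact ext_inner_left ℂ fun η ↦ by simpa [inner_sub_right] using (hzero ξ η).2

/-- Conjugation by an isometry that preserves the algebra. -/
noncomputable def conj (V : H →L[ℂ] H) (hV : star V * V = 1) (hN : ∀ a ∈ N, star V * a * V ∈ N) :
    Channel N where
  toLinearMap :=
    { toFun := fun a ↦ ⟨star V * (a : H →L[ℂ] H) * V, hN a a.2⟩
      map_add' := fun a b ↦ Subtype.ext (by simp [mul_add, add_mul])
      map_smul' := fun c a ↦ Subtype.ext (by simp) }
  map_one := Subtype.ext (by simpa using hV)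
  completelyPositive k a ha x := by
    have := ha fun i ↦ V (x i)
    simpa [ContinuousLinearMap.star_eq_adjoint, ContinuousLinearMap.adjoint_inner_right] using this

end Channel

/-- The vector state of a unit vector. -/
noncomputable def AlgState.ofVector (N : VonNeumannAlgebra H) (ξ : H) (hξ : ‖ξ‖ = 1) :
    AlgState N where
  toLinearMap :=
    { toFun := fun a ↦ ⟪ξ, (a : H →L[ℂ] H) ξ⟫_ℂ
      map_add' := fun a b ↦ by simp
      map_smul' := fun c a ↦ by simp }
  map_one := by simp [inner_self_eq_norm_sq_to_K, hξ]
  nonneg a := by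
    change 0 ≤ ⟪ξ, (star (a : H →L[ℂ] H) * (a : H →L[ℂ] H)) ξ⟫_ℂ
    rw [ContinuousLinearMap.star_eq_adjoint, mul_apply_eq_comp,
      ContinuousLinearMap.adjoint_inner_right]
    exact zero_le_inner_self_complex _

theorem AlgState.eq_zero_of_forall {N : VonNeumannAlgebra H} {a : N.toStarSubalgebra}
    (h : ∀ ρ : AlgState N, ρ.toLinearMap a = 0) : a = 0 := by
  have h0 : ((a : H →L[ℂ] H) : H →ₗ[ℂ] H) = 0 := by
    rw [← inner_map_self_eq_zero]
    intro ξ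
    by_cases hξ : ξ = 0
    · simp [hξ]
    have h1 : ⟪(‖ξ‖⁻¹ : ℂ) • ξ, (a : H →L[ℂ] H) ((‖ξ‖⁻¹ : ℂ) • ξ)⟫_ℂ = 0 :=
      h (AlgState.ofVector N _ (norm_smul_inv_norm hξ))
    have hn : (‖ξ‖ : ℂ) ≠ 0 := by simpa using hξ
    rw [map_smul, inner_smul_left, inner_smul_right] at h1
    have h2 : ⟪ξ, (a : H →L[ℂ] H) ξ⟫_ℂ = 0 := by simpa [hn] using h1
    rw [← inner_conj_symm, ContinuousLinearMap.coe_coe, h2, map_zero]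
  exact Subtype.ext (ContinuousLinearMap.coe_injective h0)

end Channels

/-! ### One-parameter unitary groups and nested commutators -/

section Exponentials

variable {H : Type*} [NormedAddCommGroup H] [InnerProductSpace ℂ H] [CompleteSpace H]

theorem exp_mem_unitary {k : H →L[ℂ] H} (hk : star k = -k) (t : ℝ) :
    NormedSpace.exp (t • k) ∈ unitary (H →L[ℂ] H) := by
  let : NormedAlgebra ℚ (H →L[ℂ] H) := NormedAlgebra.restrictScalars ℚ ℂ _
  refine NormedSpace.exp_mem_unitary_of_mem_skewAdjoint ?_
  rw [skewAdjoint.mem_iff, star_smul, hk]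
  simp

theorem hasDerivAt_conj_exp {k : H →L[ℂ] H} (hk : star k = -k) (x : H →L[ℂ] H) :
    HasDerivAt (fun t : ℝ ↦ star (NormedSpace.exp (t • k)) * x * NormedSpace.exp (t • k))
      (x * k - k * x) 0 := by
  have h1 := hasDerivAt_exp_smul_const (𝕂 := ℝ) k 0
  have h2 := hasDerivAt_exp_smul_const (𝕂 := ℝ) (-k) 0
  have e : (fun t : ℝ ↦ star (NormedSpace.exp (t • k)) * x * NormedSpace.exp (t • k)) =
      fun t : ℝ ↦ NormedSpace.exp (t • -k) * x * NormedSpace.exp (t • k) := by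
    funext t
    rw [NormedSpace.star_exp, star_smul, hk]
    simp
  rw [e]
  convert! (h2.mul_const x).mul h1 using 1
  simp
  abel

theorem commute_of_forall_conj_exp {k : H →L[ℂ] H} (hk : star k = -k) {x : H →L[ℂ] H}
    (h : ∀ t : ℝ, star (NormedSpace.exp (t • k)) * x * NormedSpace.exp (t • k) = x) :
    x * k = k * x := by
  have h1 := hasDerivAt_conj_exp hk x
  simp only [h] at h1
  exact sub_eq_zero.1 (h1.unique (hasDerivAt_const (0 : ℝ) x))

/-- The commutator `x ↦ k * x - x * k`. -/
noncomputable def commutatorMap (k : H →L[ℂ] H) : (H →L[ℂ] H) →L[ℝ] (H →L[ℂ] H) :=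
  ContinuousLinearMap.mul ℝ _ k - (ContinuousLinearMap.mul ℝ _).flip k

theorem commutatorMap_apply (k x : H →L[ℂ] H) : commutatorMap k x = k * x - x * k := rfl

/-- The nested commutator with a list of operators. -/
noncomputable def nestedCommutator :
    List (H →L[ℂ] H) → (H →L[ℂ] H) →L[ℝ] (H →L[ℂ] H)
  | [] => ContinuousLinearMap.id ℝ _
  | k :: l => (nestedCommutator l).comp (commutatorMap k)

/-- The head of the list acts first, so appending adds the outermost commutator. -/
theorem nestedCommutator_append (l : List (H →L[ℂ] H)) (k x : H →L[ℂ] H) :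
    nestedCommutator (l ++ [k]) x = k * nestedCommutator l x - nestedCommutator l x * k := by
  induction l generalizing x with
  | nil => rfl
  | cons m l ih => exact ih _

theorem star_nestedCommutator {l : List (H →L[ℂ] H)} (hl : ∀ k ∈ l, star k = -k)
    (x : H →L[ℂ] H) : star (nestedCommutator l x) = nestedCommutator l (star x) := by
  induction l generalizing x with
  | nil => rfl
  | cons m l ih =>
    change star (nestedCommutator l (m * x - x * m)) =
      nestedCommutator l (m * star x - star x * m)
    rw [ih fun k hk ↦ hl k (List.mem_cons_of_mem _ hk)]
    simp [hl m, add_comm, sub_eq_add_neg]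

end Exponentials

/-! ### Local unitaries and local channels of the QFT -/

namespace VonNeumannQFT

variable {E : Type*} [NormedAddCommGroup E] [NormedSpace ℝ E]
  {M : Type*} [TopologicalSpace M] [ChartedSpace E M] [IsManifold 𝓘(ℝ, E) ∞ M]
  {g : Spacetime E M}
  {H : Type*} [NormedAddCommGroup H] [InnerProductSpace ℂ H] [CompleteSpace H]
  (A : VonNeumannQFT g H)

theorem mem_commutant_algebra {T : Set M} {y : H →L[ℂ] H} :
    y ∈ (A.algebra T).commutant ↔
      ∀ R : g.Region, R.1 ⊆ T → ∀ a ∈ A.localAlgebra R, a * y = y * a := by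
  rw [algebra, mem_commutant_vonNeumannGenerated]
  · exact ⟨fun h R hR a ha ↦ h a ⟨R, hR, ha⟩, fun h a ⟨R, hR, ha⟩ ↦ h R hR a ha⟩
  · rintro a ⟨R, hR, ha⟩
    exact ⟨R, hR, star_mem ha⟩

theorem algebra_mono {S T : Set M} (h : S ⊆ T) : A.algebra S ≤ A.algebra T := by
  intro a ha
  refine VonNeumannAlgebra.mem_of_forall_commutant fun y hy ↦ ?_
  refine (VonNeumannAlgebra.commute_of_mem ha ?_).symm
  rw [mem_commutant_algebra] at hy ⊢
  exact fun R hR ↦ hy R (hR.trans h)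

theorem algebra_le_globalAlgebra (T : Set M) : A.algebra T ≤ A.globalAlgebra :=
  A.algebra_mono (Set.subset_univ T)

variable {A}

/-- The unitaries local to `K` that map `𝔄(R)` into `𝔄(S^⊥)` under conjugation. -/
def localizingUnitaries (A : VonNeumannQFT g H) (K R S : Set M) : Set (A.LocalUnitary K) :=
  {U | ∀ a ∈ A.algebra R, star U.1 * a * U.1 ∈ A.algebra (g.spacelikeComplement S)}

theorem LocalUnitary.star_mul_self {K : Set M} (U : A.LocalUnitary K) : star U.1 * U.1 = 1 :=
  (Unitary.mem_iff.1 U.2.1).1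

theorem LocalUnitary.mul_star_self {K : Set M} (U : A.LocalUnitary K) : U.1 * star U.1 = 1 :=
  (Unitary.mem_iff.1 U.2.1).2

theorem LocalUnitary.continuous_apply {K : Set M} (x : H) :
    Continuous fun U : A.LocalUnitary K ↦ U.1 x := by
  have h : Continuous fun (U : A.LocalUnitary K) (x : H) ↦ U.1 x := by
    refine continuous_iff_le_induced.2 (le_of_eq ?_)
    exact induced_compose
  exact (_root_.continuous_apply x).comp h

theorem LocalUnitary.continuous_of_apply {K : Set M} {X : Type*} [TopologicalSpace X]
    {f : X → A.LocalUnitary K} (hf : ∀ x : H, Continuous fun t ↦ (f t).1 x) : Continuous f :=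
  continuous_induced_rng.2 (continuous_induced_rng.2 (continuous_pi hf))

/-- Taking matrix elements and moving `U†` to the other side of the inner product leaves only
vectors `U ξ`, which are SOT-continuous in `U`; continuity of the adjoint is not needed. -/
theorem isClosed_localizingUnitaries (K R S : Set M) :
    IsClosed (A.localizingUnitaries K R S) := by
  have e : A.localizingUnitaries K R S =
      ⋂ a ∈ A.algebra R, ⋂ y ∈ (A.algebra (g.spacelikeComplement S)).commutant,
        ⋂ ξ : H, ⋂ η : H, {U : A.LocalUnitary K |
          ⟪U.1 (star y ξ), a (U.1 η)⟫_ℂ = ⟪U.1 ξ, a (U.1 (y η))⟫_ℂ} := by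
    ext U
    simp only [Set.mem_iInter, Set.mem_ofPred_eq, localizingUnitaries]
    refine forall₂_congr fun a ha ↦ ?_
    have key : ∀ (y : H →L[ℂ] H) (ξ η : H),
        ⟪U.1 (star y ξ), a (U.1 η)⟫_ℂ = ⟪ξ, (y * (star U.1 * a * U.1)) η⟫_ℂ ∧
        ⟪U.1 ξ, a (U.1 (y η))⟫_ℂ = ⟪ξ, (star U.1 * a * U.1 * y) η⟫_ℂ := by
      intro y ξ η
      simp [ContinuousLinearMap.star_eq_adjoint,
        ← ContinuousLinearMap.adjoint_inner_left]
    constructor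
    · intro h y hy ξ η
      rw [(key y ξ η).1, (key y ξ η).2, VonNeumannAlgebra.commute_of_mem h hy]
    · intro h
      refine VonNeumannAlgebra.mem_of_forall_commutant fun y hy ↦ ?_
      ext η
      refine ext_inner_left ℂ fun ξ ↦ ?_
      rw [← (key y ξ η).1, ← (key y ξ η).2]
      exact h y hy ξ η
  rw [e]
  refine isClosed_biInter fun a _ ↦ isClosed_biInter fun y _ ↦ isClosed_iInter fun ξ ↦
    isClosed_iInter fun η ↦ isClosed_eq ?_ ?_
  · exact (LocalUnitary.continuous_apply _).inner
      (a.continuous.comp (LocalUnitary.continuous_apply _))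
  · exact (LocalUnitary.continuous_apply _).inner
      (a.continuous.comp (LocalUnitary.continuous_apply _))

/-- Right translation of a local unitary by the exponential of a local skew-adjoint operator. -/
noncomputable def LocalUnitary.mulExp {K : Set M} (U : A.LocalUnitary K) {k : H →L[ℂ] H}
    (hk : k ∈ (A.algebra (g.spacelikeComplement K)).commutant) (hs : star k = -k) (t : ℝ) :
    A.LocalUnitary K :=
  ⟨U.1 * NormedSpace.exp (t • k), mul_mem U.2.1
    (exp_mem_unitary hs t),
    mul_mem U.2.2 (VonNeumannAlgebra.exp_mem _ (VonNeumannAlgebra.real_smul_mem _ t hk))⟩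

theorem LocalUnitary.mulExp_zero {K : Set M} (U : A.LocalUnitary K) {k : H →L[ℂ] H}
    (hk : k ∈ (A.algebra (g.spacelikeComplement K)).commutant) (hs : star k = -k) :
    U.mulExp hk hs 0 = U :=
  Subtype.ext (by simp [mulExp])

theorem LocalUnitary.continuous_mulExp {K : Set M} (U : A.LocalUnitary K) {k : H →L[ℂ] H}
    (hk : k ∈ (A.algebra (g.spacelikeComplement K)).commutant) (hs : star k = -k) :
    Continuous (U.mulExp hk hs) := by
  refine LocalUnitary.continuous_of_apply fun x ↦ ?_
  have h1 : Continuous fun t : ℝ ↦ NormedSpace.exp (t • k) :=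
    continuous_iff_continuousAt.2 fun t ↦ (hasDerivAt_exp_smul_const k t).continuousAt
  exact U.1.continuous.comp (h1.clm_apply continuous_const)

/-- Each commutator is a derivative at `t = 0` along `U exp(tk)`, which stays in `O` for small `t`;
commuting with a fixed `y` passes to derivatives. -/
theorem nestedCommutator_mem_of_isOpen {K R S : Set M} {O : Set (A.LocalUnitary K)}
    (hO : IsOpen O) (hOR : O ⊆ A.localizingUnitaries K R S) {l : List (H →L[ℂ] H)}
    (hl : ∀ k ∈ l, k ∈ (A.algebra (g.spacelikeComplement K)).commutant ∧ star k = -k)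
    {U : A.LocalUnitary K} (hU : U ∈ O) {a : H →L[ℂ] H} (ha : a ∈ A.algebra R) :
    nestedCommutator l (star U.1 * a * U.1) ∈ A.algebra (g.spacelikeComplement S) := by
  -- `φ` stands for the commutators with the tail of the list. Membership is required at all points
  -- of `O`, so that it can be differentiated again.
  suffices h : ∀ φ : (H →L[ℂ] H) →L[ℝ] (H →L[ℂ] H),
      (∀ U ∈ O, φ (star U.1 * a * U.1) ∈ A.algebra (g.spacelikeComplement S)) →
      ∀ k ∈ (A.algebra (g.spacelikeComplement K)).commutant, star k = -k →
      ∀ U ∈ O, φ (commutatorMap k (star U.1 * a * U.1)) ∈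
        A.algebra (g.spacelikeComplement S) by
    induction l generalizing U with
    | nil => exact hOR hU a ha
    | cons k l ih =>
      exact h _ (fun W hW ↦ ih (fun m hm ↦ hl m (List.mem_cons_of_mem _ hm)) hW) k
        (hl k List.mem_cons_self).1 (hl k List.mem_cons_self).2 U hU
  intro φ hφ k hk hs U hU
  refine VonNeumannAlgebra.mem_of_forall_commutant fun y hy ↦ ?_
  have hd := φ.hasFDerivAt.comp_hasDerivAt (0 : ℝ) (hasDerivAt_conj_exp hs (star U.1 * a * U.1))
  have hd' := (hd.const_mul y).sub (hd.mul_const y)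
  have hev : ∀ᶠ t in nhds (0 : ℝ), U.mulExp hk hs t ∈ O := by
    refine (U.continuous_mulExp hk hs).continuousAt.eventually_mem (hO.mem_nhds ?_)
    rwa [U.mulExp_zero hk hs]
  have h0 := hd'.unique ((hasDerivAt_const (0 : ℝ) (0 : H →L[ℂ] H)).congr_of_eventuallyEq ?_)
  · rw [commutatorMap_apply, ← sub_eq_zero, ← neg_sub (star U.1 * a * U.1 * k), map_neg]
    rw [mul_neg, neg_mul, ← neg_sub', neg_eq_zero]
    exact h0
  · filter_upwards [hev] with t ht
    have h1 := VonNeumannAlgebra.commute_of_mem (hφ _ ht) hy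
    have e : star (U.mulExp hk hs t).1 * a * (U.mulExp hk hs t).1 =
        star (NormedSpace.exp (t • k)) * (star U.1 * a * U.1) * NormedSpace.exp (t • k) := by
      simp [LocalUnitary.mulExp, mul_assoc]
    rw [e] at h1
    exact sub_eq_zero.2 h1.symm

/-- If conjugation by all unitaries in a nonempty open set maps `𝔄(R)` into `𝔄(S^⊥)`, then so
does every channel that is local to `K`. -/
theorem map_mem_of_interior_nonempty {K R S : Set M}
    (hint : (interior (A.localizingUnitaries K R S)).Nonempty) {Φ : Channel A.globalAlgebra}
    (hΦ : A.IsLocalChannel K Φ) {a : A.globalAlgebra.toStarSubalgebra}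
    (ha : (a : H →L[ℂ] H) ∈ A.algebra R) :
    (Φ.toLinearMap a : H →L[ℂ] H) ∈ A.algebra (g.spacelikeComplement S) := by
  obtain ⟨U, hU⟩ := hint
  set P := A.algebra (g.spacelikeComplement K) with hP
  set X : Set (H →L[ℂ] H) := {x | ∃ l : List (H →L[ℂ] H),
    (∀ k ∈ l, k ∈ P.commutant ∧ star k = -k) ∧ ∃ b ∈ A.algebra R,
      x = nestedCommutator l (star U.1 * b * U.1)} with hX
  set N := vonNeumannGenerated X with hN
  have hXs : ∀ x ∈ X, star x ∈ X := by
    rintro _ ⟨l, hl, b, hb, rfl⟩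
    refine ⟨l, hl, star b, star_mem hb, ?_⟩
    rw [star_nestedCommutator fun k hk ↦ (hl k hk).2]
    simp [mul_assoc]
  have hNS : N ≤ A.algebra (g.spacelikeComplement S) := by
    intro x hx
    refine VonNeumannAlgebra.mem_of_forall_commutant fun y hy ↦ ?_
    refine (VonNeumannAlgebra.commute_of_mem hx ?_).symm
    rw [hN, mem_commutant_vonNeumannGenerated hXs]
    rintro _ ⟨l, hl, b, hb, rfl⟩
    exact VonNeumannAlgebra.commute_of_mem
      (nestedCommutator_mem_of_isOpen isOpen_interior interior_subset hl hU hb) hy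
  have hskew : ∀ k ∈ P.commutant, star k = -k → ∀ x ∈ N, k * x - x * k ∈ N := by
    intro k hk hs x hx
    refine VonNeumannAlgebra.commutator_mem_of_generators hXs ?_ hx
    rintro _ ⟨l, hl, b, hb, rfl⟩
    refine subset_vonNeumannGenerated X ⟨l ++ [k], ?_, b, hb, (nestedCommutator_append l k _).symm⟩
    intro m hm
    rcases List.mem_append.1 hm with hm | hm
    · exact hl m hm
    · obtain rfl := List.mem_singleton.1 hm
      exact ⟨hk, hs⟩
  have hder : ∀ b ∈ P.commutant, ∀ x ∈ N, b * x - x * b ∈ N := by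
    intro b hb x hx
    obtain ⟨p, hp, q, hq, hps, hqs, rfl⟩ := P.commutant.exists_skewAdjoint_add hb
    have e : (p + Complex.I • q) * x - x * (p + Complex.I • q) =
        (p * x - x * p) + Complex.I • (q * x - x * q) := by
      rw [mul_add, add_mul, mul_smul_comm, smul_mul_assoc, smul_sub]; abel
    rw [e]
    exact add_mem (hskew p hp hps x hx) (N.smul_mem _ (hskew q hq hqs x hx))
  -- `N` is built from `U† a U`; conjugating back by `U ∈ B` stays in `N`.
  have haN : (a : H →L[ℂ] H) ∈ N := by
    have h1 : star U.1 * (a : H →L[ℂ] H) * U.1 ∈ N :=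
      subset_vonNeumannGenerated X ⟨[], by simp, a, ha, rfl⟩
    have h2 := VonNeumannAlgebra.conj_unitary_mem hder (star_mem U.2.2)
      (by rw [star_star]; exact U.mul_star_self) h1
    have e : star (star U.1) * (star U.1 * (a : H →L[ℂ] H) * U.1) * star U.1 = a := by
      calc _ = U.1 * star U.1 * a * (U.1 * star U.1) := by rw [star_star]; noncomm_ring
        _ = a := by rw [U.mul_star_self]; simp
    rwa [e] at h2
  obtain ⟨z, hz, hzN, hzN', hzB, hBz, hBz'⟩ := VonNeumannAlgebra.exists_central_projection hder
  rw [VonNeumannAlgebra.commutant_commutant] at hzB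
  have hglob : ∀ {p : H →L[ℂ] H}, p ∈ P → p ∈ A.globalAlgebra :=
    fun hp ↦ A.algebra_le_globalAlgebra _ hp
  have hmod : ∀ (p : H →L[ℂ] H) (hp : p ∈ P) (x : A.globalAlgebra.toStarSubalgebra),
      Φ.toLinearMap (⟨p, hglob hp⟩ * x) = ⟨p, hglob hp⟩ * Φ.toLinearMap x ∧
      Φ.toLinearMap (x * ⟨p, hglob hp⟩) = Φ.toLinearMap x * ⟨p, hglob hp⟩ := by
    intro p hp x
    constructor
    · have := (Φ.map_star_mul_of_fixed (p := star ⟨p, hglob hp⟩) (hΦ _ (star_mem hp))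
        (hΦ _ (star_mem (star_mem hp)))
        (hΦ _ (mul_mem (star_mem (star_mem hp)) (star_mem hp))) x).1
      rwa [star_star] at this
    · have := (Φ.map_star_mul_of_fixed (p := ⟨p, hglob hp⟩) (hΦ _ hp)
        (hΦ _ (star_mem hp)) (hΦ _ (mul_mem (star_mem hp) hp)) (star x)).2
      rwa [star_star] at this
  refine hNS (VonNeumannAlgebra.mem_of_forall_commutant fun y hy ↦ ?_)
  -- `y` commutes with `b z ∈ N` and `z` with `b`, so `y z` commutes with all of `B`, and `B' = P`.
  have hyz : y * z ∈ P := by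
    refine VonNeumannAlgebra.mem_of_forall_commutant fun b hb ↦ ?_
    have h1 := VonNeumannAlgebra.commute_of_mem (hBz b hb) hy
    have h2 := VonNeumannAlgebra.commute_of_mem hzB hb
    have h3 := VonNeumannAlgebra.commute_of_mem hzN hy
    rw [← h3, ← mul_assoc, h1, ← h2]
    simp only [← mul_assoc, h3]
  -- `a ∈ N` commutes with `b (1 - z) ∈ N'`, so this part of `a` lies in `P` and is fixed by `Φ`.
  have hza : (a : H →L[ℂ] H) * (1 - z) ∈ P := by
    refine VonNeumannAlgebra.mem_of_forall_commutant fun b hb ↦ ?_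
    have h1 := VonNeumannAlgebra.commute_of_mem haN (hBz' b hb)
    have h2 := VonNeumannAlgebra.commute_of_mem hzB hb
    have h3 := VonNeumannAlgebra.commute_of_mem haN hzN'
    have e1 : b * ((a : H →L[ℂ] H) * (1 - z)) = b * (1 - z) * a := by
      rw [mul_sub, mul_one, h3]; noncomm_ring
    have e2 : (a : H →L[ℂ] H) * (1 - z) * b = a * (b * (1 - z)) := by
      rw [mul_assoc, sub_mul, h2]; noncomm_ring
    rw [e1, e2, h1]
  set z' : A.globalAlgebra.toStarSubalgebra := ⟨z, hglob hzB⟩ with hz'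
  set w : A.globalAlgebra.toStarSubalgebra := ⟨y * z, hglob hyz⟩ with hw
  have hsplit : Φ.toLinearMap a = Φ.toLinearMap (a * z') + a * (1 - z') := by
    have h1 : Φ.toLinearMap (a * (1 - z')) = a * (1 - z') := hΦ _ hza
    rw [← h1, ← map_add, ← mul_add, add_sub_cancel, mul_one]
  have hzz : z' * z' = z' := Subtype.ext hz
  have hzacomm : a * z' = z' * a := Subtype.ext (VonNeumannAlgebra.commute_of_mem haN hzN')
  have hwcomm : w * (a * z') = (a * z') * w := by
    refine Subtype.ext ?_
    change y * z * (a * z) = a * z * (y * z)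
    exact (VonNeumannAlgebra.commute_of_mem (mul_mem haN hzN)
      (mul_mem hy hzN')).symm
  have hwΦ : w * Φ.toLinearMap (a * z') = Φ.toLinearMap (a * z') * w := by
    rw [← (hmod _ hyz _).1, ← (hmod _ hyz _).2, hwcomm]
  have hzl : z' * Φ.toLinearMap (a * z') = Φ.toLinearMap (a * z') := by
    rw [← (hmod _ hzB _).1, ← hz', hzacomm, ← mul_assoc, hzz]
  have hzr : Φ.toLinearMap (a * z') * z' = Φ.toLinearMap (a * z') := by
    rw [← (hmod _ hzB _).2, ← hz', mul_assoc, hzz]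
  set F : H →L[ℂ] H := (Φ.toLinearMap (a * z') : H →L[ℂ] H) with hF
  have hwF : y * z * F = F * (y * z) := congrArg Subtype.val hwΦ
  have hzlF : z * F = F := congrArg Subtype.val hzl
  have hzrF : F * z = F := congrArg Subtype.val hzr
  -- `F` lives under `z`, so commuting with `y z` is the same as commuting with `y`.
  have hyF : y * F = F * y := by
    calc y * F = y * z * F := by rw [mul_assoc, hzlF]
      _ = F * (z * y) := by rw [hwF, VonNeumannAlgebra.commute_of_mem hzN hy]
      _ = F * y := by rw [← mul_assoc, hzrF]
  have hrest := VonNeumannAlgebra.commute_of_mem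
    (mul_mem haN (sub_mem (one_mem N) hzN)) hy
  have hsplit' : (Φ.toLinearMap a : H →L[ℂ] H) = F + (a : H →L[ℂ] H) * (1 - z) :=
    congrArg Subtype.val hsplit
  rw [hsplit', mul_add, add_mul, hyF, hrest]

/-- Causality is tested with the channels of conjugation by `exp(tk)`, `k` skew-adjoint in
`𝔄(S^⊥)'`. Invariance under them means commuting with every such `k`, hence membership in the
bicommutant `𝔄(S^⊥)`. -/
theorem causalUnitaries_subset (hchan : A.UnitariesDefineChannels) {K R S : Set M}
    (hS : IsCompact S) (hR : IsCompact R) (hSK : S ⊆ g.inRegion K) (hRK : R ⊆ g.outRegion K)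
    (hSR : g.SpacelikeSeparated S R) :
    A.causalUnitaries K ⊆ A.localizingUnitaries K R S := by
  rintro U ⟨Φ, hΦ, hΦU⟩ a ha
  have haM : a ∈ A.globalAlgebra := A.algebra_le_globalAlgebra _ ha
  have haU : star U.1 * a * U.1 = (Φ.toLinearMap ⟨a, haM⟩ : H →L[ℂ] H) := (hΦU ⟨a, haM⟩).symm
  rw [haU]
  refine VonNeumannAlgebra.mem_of_forall_commutant fun y hy ↦ ?_
  have hskew : ∀ k ∈ (A.algebra (g.spacelikeComplement S)).commutant, star k = -k →
      (Φ.toLinearMap ⟨a, haM⟩ : H →L[ℂ] H) * k = k * (Φ.toLinearMap ⟨a, haM⟩ : H →L[ℂ] H) := by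
    intro k hk hs
    refine commute_of_forall_conj_exp hs fun t ↦ ?_
    have hmem := VonNeumannAlgebra.exp_mem _ (VonNeumannAlgebra.real_smul_mem _ t hk)
    let V : A.LocalUnitary S := ⟨NormedSpace.exp (t • k),
      exp_mem_unitary hs t, hmem⟩
    let Ψ : Channel A.globalAlgebra := Channel.conj V.1 V.star_mul_self (hchan S hS V)
    have hΨ : A.IsLocalChannel S Ψ := by
      intro b hb
      refine Subtype.ext ?_
      change star V.1 * (b : H →L[ℂ] H) * V.1 = b
      rw [mul_assoc, VonNeumannAlgebra.commute_of_mem hb V.2.2, ← mul_assoc, V.star_mul_self,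
        one_mul]
    have h0 := AlgState.eq_zero_of_forall
      (hΦ.2 S R hS hR hSK hRK hSR Ψ hΨ ⟨a, haM⟩ ha)
    exact congrArg Subtype.val (sub_eq_zero.1 h0)
  obtain ⟨p, hp, q, hq, hps, hqs, rfl⟩ := VonNeumannAlgebra.exists_skewAdjoint_add _ hy
  rw [add_mul, mul_add, hskew p hp hps, smul_mul_assoc, mul_smul_comm, hskew q hq hqs]

end VonNeumannQFT

/-- If some channel local to `K` is not causal, then the causal unitaries are meagre in the group
of all unitaries local to `K`, with respect to the strong operator topology. -/
theorem theorem2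
    {E : Type*} [NormedAddCommGroup E] [NormedSpace ℝ E] [FiniteDimensional ℝ E]
    {M : Type*} [TopologicalSpace M] [T2Space M] [SecondCountableTopology M]
    [ChartedSpace E M] [IsManifold 𝓘(ℝ, E) ∞ M]
    (g : Spacetime E M) (hg : g.GloballyHyperbolic)
    {H : Type*} [NormedAddCommGroup H] [InnerProductSpace ℂ H] [CompleteSpace H]
    (A : VonNeumannQFT g H)
    (hloc : ∀ R : g.Region, R.1.Nonempty →
      SOTSeparable (A.localAlgebra R) ∨ ProperlyInfinite (A.localAlgebra R))
    (hchan : A.UnitariesDefineChannels)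
    (K : Set M)
    (hacausal : ∃ Φ : Channel A.globalAlgebra, A.IsLocalChannel K Φ ∧ ¬ A.IsCausalChannel K Φ) :
    IsMeagre (A.causalUnitaries K) := by
  obtain ⟨Φ, hΦ, hacausal⟩ := hacausal
  simp only [VonNeumannQFT.IsCausalChannel, hΦ, true_and] at hacausal
  push Not at hacausal
  obtain ⟨S, R, hS, hR, hSK, hRK, hSR, Ψ, hΨ, a, ha, ρ, hρ⟩ := hacausal
  refine IsMeagre.mono (VonNeumannQFT.causalUnitaries_subset hchan hS hR hSK hRK hSR)
    (IsNowhereDense.isMeagre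
      ((VonNeumannQFT.isClosed_localizingUnitaries K R S).isNowhereDense_iff.2 ?_))
  by_contra hne
  refine hρ ?_
  rw [hΨ _ (VonNeumannQFT.map_mem_of_interior_nonempty (Set.nonempty_iff_ne_empty.2 hne) hΦ ha),
    sub_self, map_zero]
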